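/- Let $X$ and $Y$ be real locally convex topological vector spaces with topological duals $X^*$ and $Y^*$, let $A\colon X\to Y$ be a continuous linear mapping with adjoint $A^*\colon Y^*\to X^*$, $\langle A^*y^*,x\rangle=\langle y^*,Ax\rangle$, and let $g\colon Y\to(-\infty,\infty]$ be a proper convex function, where proper means that $\operatorname{dom} g:=\{y\in Y\mid g(y)<\infty\}$ is nonempty. Suppose that $g$ is polyhedral, i.e. its epigraph $\{(y,t)\in Y\times\mathbb R\mid g(y)\le t\}$ is the set of solutions $z$ of finitely many inequalities $\langle \varphi_i,z\rangle\le\alpha_i$ with $\varphi_i\in (Y\times\mathbb R)^*$ and $\alpha_i\in\mathbb R$, and that $$A(X)\cap\operatorname{dom} g\neq\emptyset .$$ For an extended-real-valued function $f$ on a locally convex space $E$ let $f^*(x^*):=\sup\{\langle x^*,x\rangle-f(x)\mid x\in E\}$, $x^*\in E^*$, be its Fenchel conjugate. Then $$(g\circ A)^*(x^*)=\inf\{g^*(y^*)\mid y^*\in Y^*,\ A^*y^*=x^*\}\quad\text{for all }x^*\in X^*,$$ where $\inf\emptyset:=\infty$. Furthermore, for every $x^*\in X^*$ with $(g\circ A)^*(x^*)<\infty$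 there exists $y^*\in Y^*$ such that $A^*y^*=x^*$ and $(g\circ A)^*(x^*)=g^*(y^*)$. -/

import Mathlib

namespace PolyFenchel

/-- The epigraph `{(x, t) ∈ E × ℝ | f x ≤ t}` of an extended-real-valued function. -/
def epi {E : Type*} (f : E → EReal) : Set (E × ℝ) :=
  {p | f p.1 ≤ (p.2 : EReal)}

/-- The effective domain `{x | f x < ∞}`. -/
def dom {E : Type*} (f : E → EReal) : Set E :=
  {x | f x < ⊤}

/-- A proper function: it takes values in `(-∞, ∞]` and is not identically `∞`. -/
def IsProper {E : Type*} (f : E → EReal) : Prop :=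
  (∀ x, f x ≠ ⊥) ∧ (dom f).Nonempty

/-- A convex extended-real-valued function: its epigraph is a convex set. -/
def IsConvexFun {E : Type*} [AddCommGroup E] [Module ℝ E] (f : E → EReal) : Prop :=
  Convex ℝ (epi f)

/-- A polyhedral set: the solution set of finitely many inequalities `⟨φ i, x⟩ ≤ α i` given by
continuous linear functionals `φ i` and real numbers `α i`. -/
def IsPolyhedralSet {E : Type*} [AddCommGroup E] [Module ℝ E] [TopologicalSpace E]
    (P : Set E) : Prop :=
  ∃ (k : ℕ) (φ : Fin k → StrongDual ℝ E) (α : Fin k → ℝ), P = {x | ∀ i, φ i x ≤ α i}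

/-- A polyhedral function: its epigraph is a polyhedral set in `E × ℝ`. -/
def IsPolyhedralFun {E : Type*} [AddCommGroup E] [Module ℝ E] [TopologicalSpace E]
    (f : E → EReal) : Prop :=
  IsPolyhedralSet (epi f)

/-- The Fenchel conjugate `f* (x*) = sup {⟨x*, x⟩ - f x | x ∈ E}` on the topological dual. -/
noncomputable def conj {E : Type*} [AddCommGroup E] [Module ℝ E] [TopologicalSpace E]
    (f : E → EReal) (xs : StrongDual ℝ E) : EReal :=
  ⨆ x : E, ((xs x : ℝ) : EReal) - f x

/-- The adjoint `A* : Y* → X*`, `⟨A* y*, x⟩ = ⟨y*, A x⟩`, of a continuous linear mapping. -/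
def adj {X Y : Type*} [AddCommGroup X] [Module ℝ X] [TopologicalSpace X]
    [AddCommGroup Y] [Module ℝ Y] [TopologicalSpace Y]
    (A : X →L[ℝ] Y) (ys : StrongDual ℝ Y) : StrongDual ℝ X :=
  ContinuousLinearMap.comp ys A

end PolyFenchel

/-!
The theorem reduces to Farkas' lemma, which for finitely many linear functionals is purely
algebraic and so needs no separation argument, no constraint qualification and no closedness of
the image cone.

Write the epigraph of `g` as `{z | ∀ i, φ i z ≤ α i}`. If `r := (g ∘ A)* (xs)` is finite, every
`(x, t)` with `φ i (A x, t) ≤ α i` for all `i` satisfies `xs x - t ≤ r`; this system is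
feasible because the range of `A` meets `dom g`. The affine form of Farkas' lemma
(`exists_nonneg_sum_eq_of_forall_le`) gives `c i ≥ 0` with
`xs x - t = ∑ i, c i * φ i (A x, t)` for all `(x, t)` and `∑ i, c i * α i ≤ r`. The functional
`ys y := ∑ i, c i * φ i (y, 0)` is continuous, satisfies `A* ys = xs`, and since
`∑ i, c i * φ i (0, 1) = -1`, it satisfies `ys y - t ≤ ∑ i, c i * α i ≤ r` on the whole epigraph
of `g`, that is `g* (ys) ≤ r`. The reverse inequality `(g ∘ A)* (A* ys) ≤ g* (ys)` is trivial.
-/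

namespace PolyFenchel

section Farkas

variable {𝕜 V ι : Type*} [Field 𝕜] [LinearOrder 𝕜] [IsStrictOrderedRing 𝕜]
  [AddCommGroup V] [Module 𝕜 V]

/-- **Farkas' lemma** for finitely many linear functionals on an arbitrary vector space. The
induction follows Bartl: if the last functional `ψ` is needed, there is a vector `u` with
`ψ u = 1` violating the conclusion for the others, and the projection `v ↦ v - ψ v • u` onto
`ker ψ` eliminates `ψ`. -/
theorem exists_nonneg_sum_eq_of_forall_nonpos (s : Finset ι) (φ : ι → V →ₗ[𝕜] 𝕜)
    (f : V →ₗ[𝕜] 𝕜) (h : ∀ v, (∀ i ∈ s, φ i v ≤ 0) → f v ≤ 0) :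
    ∃ c : ι → 𝕜, (∀ i, 0 ≤ c i) ∧ ∀ v, f v = ∑ i ∈ s, c i * φ i v := by
  classical
  induction s using Finset.induction_on generalizing φ f with
  | empty =>
    refine ⟨0, fun _ => le_rfl, fun v => ?_⟩
    have h₁ := h v (by simp)
    have h₂ := h (-v) (by simp)
    rw [map_neg] at h₂
    rw [Finset.sum_empty]
    linarith
  | insert j s hj ih =>
    by_cases hs : ∀ v, (∀ i ∈ s, φ i v ≤ 0) → f v ≤ 0
    · obtain ⟨c, hc, hf⟩ := ih φ f hs
      refine ⟨Function.update c j 0, fun i => ?_, fun v => ?_⟩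
      · rcases eq_or_ne i j with rfl | hij
        · simp
        · simpa [hij] using hc i
      · rw [hf, Finset.sum_insert hj, Function.update_self, zero_mul, zero_add]
        refine Finset.sum_congr rfl fun i hi => ?_
        rw [Function.update_of_ne (ne_of_mem_of_not_mem hi hj)]
    · push Not at hs
      obtain ⟨w, hw, hfw⟩ := hs
      have hjw : 0 < φ j w := by
        by_contra! hle
        refine hfw.not_ge (h w fun i hi => ?_)
        rcases Finset.mem_insert.1 hi with rfl | hi
        exacts [hle, hw i hi]
      obtain ⟨u, hu, hfu, hju⟩ : ∃ u, (∀ i ∈ s, φ i u ≤ 0) ∧ 0 < f u ∧ φ j u = 1 := by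
        refine ⟨(φ j w)⁻¹ • w, fun i hi => ?_, ?_, ?_⟩
        · rw [map_smul, smul_eq_mul]
          exact mul_nonpos_of_nonneg_of_nonpos (inv_nonneg.2 hjw.le) (hw i hi)
        · rw [map_smul, smul_eq_mul]
          positivity
        · rw [map_smul, smul_eq_mul, inv_mul_cancel₀ hjw.ne']
      obtain ⟨c, hc, hf⟩ := ih (fun i => φ i - φ i u • φ j) (f - f u • φ j) fun v hv => by
        have key := h (v - φ j v • u) fun i hi => by
          rcases Finset.mem_insert.1 hi with rfl | hi
          · simp [hju]
          · have := hv i hi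
            simp only [LinearMap.sub_apply, LinearMap.smul_apply, smul_eq_mul] at this
            simp only [map_sub, map_smul, smul_eq_mul]
            linarith
        simp only [map_sub, map_smul, smul_eq_mul] at key
        simp only [LinearMap.sub_apply, LinearMap.smul_apply, smul_eq_mul]
        linarith
      have hsum : ∑ i ∈ s, c i * φ i u ≤ 0 :=
        Finset.sum_nonpos fun i hi => mul_nonpos_of_nonneg_of_nonpos (hc i) (hu i hi)
      refine ⟨Function.update c j (f u - ∑ i ∈ s, c i * φ i u), fun i => ?_, fun v => ?_⟩
      · rcases eq_or_ne i j with rfl | hij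
        · rw [Function.update_self]
          linarith
        · simpa [hij] using hc i
      · have hfv := hf v
        simp only [LinearMap.sub_apply, LinearMap.smul_apply, smul_eq_mul, mul_sub,
          ← mul_assoc, Finset.sum_sub_distrib, ← Finset.sum_mul] at hfv
        have hupd : ∑ i ∈ s, Function.update c j (f u - ∑ i ∈ s, c i * φ i u) i * φ i v =
            ∑ i ∈ s, c i * φ i v :=
          Finset.sum_congr rfl fun i hi => by
            rw [Function.update_of_ne (ne_of_mem_of_not_mem hi hj)]
        rw [Finset.sum_insert hj, Function.update_self, hupd]
        linarith

/-- **Farkas' lemma**, affine form: a linear inequality valid on the nonempty solution set of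
finitely many linear inequalities is dominated by a nonnegative combination of them. It is the
homogeneous form on `V × 𝕜`, where the inequality `0 ≤ s` for the extra coordinate `s` is
added to the system. -/
theorem exists_nonneg_sum_eq_of_forall_le [Fintype ι] (φ : ι → V →ₗ[𝕜] 𝕜) (α : ι → 𝕜)
    (f : V →ₗ[𝕜] 𝕜) (r : 𝕜) (hne : ∃ v, ∀ i, φ i v ≤ α i)
    (h : ∀ v, (∀ i, φ i v ≤ α i) → f v ≤ r) :
    ∃ c : ι → 𝕜, (∀ i, 0 ≤ c i) ∧ (∀ v, f v = ∑ i, c i * φ i v) ∧ ∑ i, c i * α i ≤ r := by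
  obtain ⟨v₀, hv₀⟩ := hne
  let Φ : Option ι → V × 𝕜 →ₗ[𝕜] 𝕜 := fun o =>
    o.elim (-LinearMap.snd 𝕜 V 𝕜)
      fun i => φ i ∘ₗ LinearMap.fst 𝕜 V 𝕜 - α i • LinearMap.snd 𝕜 V 𝕜
  let F : V × 𝕜 →ₗ[𝕜] 𝕜 := f ∘ₗ LinearMap.fst 𝕜 V 𝕜 - r • LinearMap.snd 𝕜 V 𝕜
  obtain ⟨c, hc, hF⟩ := exists_nonneg_sum_eq_of_forall_nonpos Finset.univ Φ F <| by
    rintro ⟨v, s⟩ hv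
    have hs : 0 ≤ s := by simpa [Φ] using hv none (Finset.mem_univ _)
    have hφ : ∀ i, φ i v ≤ α i * s := fun i => by
      simpa [Φ] using hv (some i) (Finset.mem_univ _)
    suffices f v ≤ r * s by simpa [F] using this
    rcases hs.eq_or_lt with rfl | hs
    · -- `v` is a recession direction: `f` is bounded above along the ray from `v₀`.
      simp only [mul_zero] at hφ ⊢
      by_contra! hfv
      have hray : ∀ t : 𝕜, 0 ≤ t → f v₀ + t * f v ≤ r := fun t ht => by
        simpa using h (v₀ + t • v) fun i => by
          have := mul_nonpos_of_nonneg_of_nonpos ht (hφ i)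
          simp only [map_add, map_smul, smul_eq_mul]
          linarith [hv₀ i]
      have h₀ := hray 0 le_rfl
      have h₁ := hray ((r - f v₀ + 1) / f v) (div_nonneg (by linarith) hfv.le)
      rw [div_mul_cancel₀ _ hfv.ne'] at h₁
      linarith
    · have := h (s⁻¹ • v) fun i => by
        rw [map_smul, smul_eq_mul, inv_mul_le_iff₀ hs, mul_comm]
        exact hφ i
      rwa [map_smul, smul_eq_mul, inv_mul_le_iff₀ hs, mul_comm] at this
  refine ⟨fun i => c (some i), fun i => hc _, fun v => ?_, ?_⟩
  · simpa [F, Φ, Fintype.sum_option] using hF (v, 0)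
  · have := hF (0, 1)
    simp only [LinearMap.sub_apply, LinearMap.smul_apply, LinearMap.neg_apply,
      LinearMap.comp_apply, LinearMap.fst_apply, LinearMap.snd_apply, map_zero, smul_eq_mul,
      mul_one, mul_neg, zero_sub, Fintype.sum_option, Option.elim, Finset.sum_neg_distrib,
      F, Φ] at this
    linarith [hc none]

end Farkas

section Conjugate

variable {E : Type*} [AddCommGroup E] [Module ℝ E] [TopologicalSpace E]

/-- The Fenchel conjugate is determined by the epigraph: the points where `f = ⊤` contribute
`⊥` to the supremum. -/
theorem conj_le_coe_iff {f : E → EReal} (hf : ∀ x, f x ≠ ⊥) {xs : StrongDual ℝ E} {r : ℝ} :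
    conj f xs ≤ r ↔ ∀ p ∈ epi f, xs p.1 - p.2 ≤ r := by
  rw [conj, iSup_le_iff]
  constructor
  · rintro h ⟨x, t⟩ (ht : f x ≤ t)
    have := (EReal.sub_le_sub le_rfl ht).trans (h x)
    exact_mod_cast this
  · intro h x
    induction hx : f x with
    | bot => exact absurd hx (hf x)
    | top => simp
    | coe t =>
      have := h (x, t) hx.le
      exact_mod_cast this

theorem conj_ne_bot {f : E → EReal} (hf : (dom f).Nonempty) (xs : StrongDual ℝ E) :
    conj f xs ≠ ⊥ := by
  obtain ⟨x, hx⟩ := hf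
  intro h
  have h' : ((xs x : ℝ) : EReal) - f x = ⊥ := iSup_eq_bot.1 h x
  rw [sub_eq_add_neg, EReal.add_eq_bot_iff, EReal.neg_eq_bot_iff] at h'
  exact h'.elim (EReal.coe_ne_bot _) hx.ne

variable {X Y : Type*} [AddCommGroup X] [Module ℝ X] [TopologicalSpace X]
  [AddCommGroup Y] [Module ℝ Y] [TopologicalSpace Y]

theorem conj_comp_adj_le (A : X →L[ℝ] Y) (g : Y → EReal) (ys : StrongDual ℝ Y) :
    conj (g ∘ A) (adj A ys) ≤ conj g ys :=
  iSup_le fun x => le_iSup (fun y => ((ys y : ℝ) : EReal) - g y) (A x)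

/-- Where `(g ∘ A)*` is finite, Farkas' multipliers assemble to a functional attaining the
dual value. -/
theorem exists_adj_eq_conj_le [IsTopologicalAddGroup Y] [ContinuousSMul ℝ Y]
    (A : X →L[ℝ] Y) {g : Y → EReal} (hbot : ∀ y, g y ≠ ⊥) (hpoly : IsPolyhedralFun g)
    (hdom : (Set.range A ∩ dom g).Nonempty) {xs : StrongDual ℝ X} {r : ℝ}
    (hr : conj (g ∘ A) xs ≤ r) : ∃ ys, adj A ys = xs ∧ conj g ys ≤ r := by
  obtain ⟨k, φ, α, hepi⟩ := hpoly
  have hmem : ∀ p : Y × ℝ, p ∈ epi g ↔ ∀ i, φ i p ≤ α i := fun p => by rw [hepi]; rfl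
  replace hr := (conj_le_coe_iff (f := g ∘ A) fun x => hbot (A x)).1 hr
  let B : X × ℝ →ₗ[ℝ] Y × ℝ := (A : X →ₗ[ℝ] Y).prodMap LinearMap.id
  obtain ⟨c, hc, heq, hle⟩ := exists_nonneg_sum_eq_of_forall_le
    (fun i => (φ i : Y × ℝ →ₗ[ℝ] ℝ) ∘ₗ B) α
    ((xs : X →ₗ[ℝ] ℝ) ∘ₗ LinearMap.fst ℝ X ℝ - LinearMap.snd ℝ X ℝ) r
    (by
      obtain ⟨_, ⟨x, rfl⟩, hx⟩ := hdom
      exact ⟨(x, (g (A x)).toReal), (hmem (A x, _)).1 (EReal.le_coe_toReal hx.ne)⟩)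
    fun p hp => hr p ((hmem (A p.1, p.2)).2 hp)
  have heq' : ∀ x t, xs x - t = ∑ i, c i * φ i (A x, t) := fun x t => heq (x, t)
  have hone : ∑ i, c i * φ i (0, 1) = -1 := by simpa using (heq' 0 1).symm
  let ys : StrongDual ℝ Y := ∑ i, c i • (φ i ∘L ContinuousLinearMap.inl ℝ Y ℝ)
  have hys : ∀ y, ys y = ∑ i, c i * φ i (y, 0) := fun y => by
    simp [ys]
  refine ⟨ys, ContinuousLinearMap.ext fun x => ?_, (conj_le_coe_iff hbot).2 ?_⟩
  · change ys (A x) = xs x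
    rw [hys, ← heq' x 0, sub_zero]
  · rintro ⟨y, t⟩ hyt
    have hsplit : ∀ i, φ i (y, t) = φ i (y, 0) + t * φ i (0, 1) := fun i => by
      rw [← smul_eq_mul, ← map_smul, ← map_add]
      simp
    calc ys y - t = ∑ i, c i * φ i (y, 0) + t * ∑ i, c i * φ i (0, 1) := by
          rw [hys, hone]; ring
      _ = ∑ i, c i * φ i (y, t) := by
          rw [Finset.mul_sum, ← Finset.sum_add_distrib]
          exact Finset.sum_congr rfl fun i _ => by rw [hsplit]; ring
      _ ≤ ∑ i, c i * α i :=
          Finset.sum_le_sum fun i _ => mul_le_mul_of_nonneg_left ((hmem _).1 hyt i) (hc i)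
      _ ≤ r := hle

end Conjugate

end PolyFenchel

theorem theorem6p5 {X Y : Type*}
    [AddCommGroup X] [Module ℝ X] [TopologicalSpace X] [IsTopologicalAddGroup X]
    [ContinuousSMul ℝ X] [LocallyConvexSpace ℝ X]
    [AddCommGroup Y] [Module ℝ Y] [TopologicalSpace Y] [IsTopologicalAddGroup Y]
    [ContinuousSMul ℝ Y] [LocallyConvexSpace ℝ Y]
    (A : X →L[ℝ] Y) (g : Y → EReal)
    (hproper : PolyFenchel.IsProper g) (hconvex : PolyFenchel.IsConvexFun g)
    (hpoly : PolyFenchel.IsPolyhedralFun g)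
    (hdom : (Set.range A ∩ PolyFenchel.dom g).Nonempty) :
    (∀ xs : StrongDual ℝ X,
      PolyFenchel.conj (g ∘ A) xs =
        ⨅ ys ∈ PolyFenchel.adj A ⁻¹' {xs}, PolyFenchel.conj g ys) ∧
    (∀ xs ∈ PolyFenchel.dom (PolyFenchel.conj (g ∘ A)),
      ∃ ys ∈ PolyFenchel.adj A ⁻¹' {xs},
        PolyFenchel.conj (g ∘ A) xs = PolyFenchel.conj g ys) := by
  have hattain : ∀ xs ∈ PolyFenchel.dom (PolyFenchel.conj (g ∘ A)),
      ∃ ys ∈ PolyFenchel.adj A ⁻¹' {xs},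
        PolyFenchel.conj (g ∘ A) xs = PolyFenchel.conj g ys := by
    intro xs hxs
    have hne : (PolyFenchel.dom (g ∘ A)).Nonempty := by
      obtain ⟨_, ⟨x, rfl⟩, hx⟩ := hdom
      exact ⟨x, hx⟩
    have hcoe := EReal.coe_toReal (LT.lt.ne hxs) (PolyFenchel.conj_ne_bot hne xs)
    obtain ⟨ys, rfl, hle⟩ :=
      PolyFenchel.exists_adj_eq_conj_le A hproper.1 hpoly hdom hcoe.ge
    rw [hcoe] at hle
    exact ⟨ys, rfl, (PolyFenchel.conj_comp_adj_le A g ys).antisymm hle⟩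
  refine ⟨fun xs => le_antisymm (le_iInf₂ ?_) ?_, hattain⟩
  · rintro ys rfl
    exact PolyFenchel.conj_comp_adj_le A g ys
  · rcases eq_or_ne (PolyFenchel.conj (g ∘ A) xs) ⊤ with htop | htop
    · exact htop ▸ le_top
    · obtain ⟨ys, hys, heq⟩ := hattain xs (lt_top_iff_ne_top.2 htop)
      exact heq ▸ iInf₂_le ys hys
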